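/- Let $k\ge 1$ be an integer, let $\varepsilon>0$ be real, and let $\sigma\colon\mathbb N\to(0,1)$ be any function. Then there is a constant $N=N(k,\varepsilon,\sigma)$ such that the following holds. Let $(V,E)$ be a finite (simple, undirected) graph that is $k$-stable, i.e. there do not exist vertices $v_1,\dots,v_k,w_1,\dots,w_k\in V$ such that, for all $i,j$, $E(v_i,w_j)$ holds if and only if $i\le j$. Then there are an integer $0\le n\le N$ and a partition $V=Y_0\cup Y_1\cup\dots\cup Y_n$ into pairwise disjoint sets, with $Y_1,\dots,Y_n$ nonempty (and $Y_0$ possibly empty), such that $|Y_0|\le\varepsilon|V|$ and, for all $i,j\in\{1,\dots,n\}$ (including $i=j$), $|Y_i|=|Y_j|$ and either $d(Y_i,Y_j)<\sigma(n)$ or $d(Y_i,Y_j)>1-\sigma(n)$. Here, for nonempty $X,Y\subseteq V$, $d(X,Y)=|E\cap(X\times Y)|/|X\times Y|$, where $E$ is viewed as a (symmetric) subset of $V\times V$. -/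

import Mathlib

/-- A graph is `k`-stable if there are no vertices `v₁, …, v_k, w₁, …, w_k` (not assumed to be
distinct) such that `v_i` is adjacent to `w_j` if and only if `i ≤ j`. -/
def SimpleGraph.IsStable {V : Type*} (G : SimpleGraph V) (k : ℕ) : Prop :=
  ¬ ∃ v w : Fin k → V, ∀ i j : Fin k, G.Adj (v i) (w j) ↔ i ≤ j

/-- `Y 0, Y 1, …, Y n` is a partition of `V` into pairwise disjoint sets covering `V`, in which
`Y 1, …, Y n` are nonempty and only the exceptional set `Y 0` may be empty. -/
structure IsPartitionWithExceptionalSet {V : Type*} {n : ℕ} (Y : Fin (n + 1) → Finset V) :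
    Prop where
  pairwise_disjoint : ∀ i j, i ≠ j → Disjoint (Y i) (Y j)
  covers : ∀ v : V, ∃ i, v ∈ Y i
  nonempty : ∀ i, i ≠ 0 → (Y i).Nonempty

/-! If no bound works, there is for each `m` a counterexample graph with no suitable partition
having `n ≤ m`; singletons show that it has more than `m` vertices. Along a nonprincipal
ultrafilter, sets of vertices acquire limit densities.

Stability produces atoms: inside any set of positive density there is one of positive density that
no vertex splits into two parts of positive density. Otherwise one could alternately choose vertices
and split forever, and pigeonhole would extract a half-graph (`HereditarilySplit.exists_pattern`,
`not_isStable_of_pattern`). Removing near-maximal atoms greedily leaves arbitrarily little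
(`exists_isLimitAtom_family`).

Between two atoms all rows and columns are almost constant, with error as small as desired, so by
double counting the whole pair is almost complete or almost empty
(`card_interedges_le_or_card_interedges_compl_le`). Homogeneity this strong survives cutting the
atoms into equal pieces. The number of pieces is bounded in advance by some `M`, so the error can be
chosen below what `σ n` demands for every `n ≤ M`. -/

open Filter Topology

/-! ### Limit densities along an ultrafilter. -/

section LimitDensity

variable {V : ℕ → Type*} [∀ m, Fintype (V m)]

/-- The limit along `U` of the densities of a sequence of finite sets. -/
noncomputable def limitDensity (U : Ultrafilter ℕ) (X : ∀ m, Finset (V m)) : ℝ :=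
  limUnder (U : Filter ℕ) fun m => ((X m).card : ℝ) / Fintype.card (V m)

variable (U : Ultrafilter ℕ)

theorem card_div_card_mem_Icc {W : Type*} [Fintype W] (s : Finset W) :
    (s.card : ℝ) / Fintype.card W ∈ Set.Icc (0 : ℝ) 1 :=
  ⟨by positivity, div_le_one_of_le₀ (by exact_mod_cast Finset.card_le_univ s) (by positivity)⟩

theorem tendsto_limitDensity (X : ∀ m, Finset (V m)) :
    Tendsto (fun m => ((X m).card : ℝ) / Fintype.card (V m)) U (𝓝 (limitDensity U X)) := by
  refine tendsto_nhds_limUnder ?_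
  obtain ⟨c, -, hc⟩ := (isCompact_Icc (a := (0 : ℝ)) (b := 1)).ultrafilter_le_nhds
    (U.map fun m => ((X m).card : ℝ) / Fintype.card (V m))
    (by
      rw [le_principal_iff]
      exact Ultrafilter.mem_map.2 (Eventually.of_forall fun m => card_div_card_mem_Icc (X m)))
  exact ⟨c, hc⟩

variable {U}

theorem limitDensity_nonneg (X : ∀ m, Finset (V m)) : 0 ≤ limitDensity U X :=
  ge_of_tendsto' (tendsto_limitDensity U X) fun m => (card_div_card_mem_Icc (X m)).1

theorem limitDensity_le_one (X : ∀ m, Finset (V m)) : limitDensity U X ≤ 1 :=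
  le_of_tendsto' (tendsto_limitDensity U X) fun m => (card_div_card_mem_Icc (X m)).2

theorem limitDensity_mono {X Y : ∀ m, Finset (V m)} (h : ∀ᶠ m in (U : Filter ℕ), X m ⊆ Y m) :
    limitDensity U X ≤ limitDensity U Y := by
  refine le_of_tendsto_of_tendsto (tendsto_limitDensity U X) (tendsto_limitDensity U Y) ?_
  filter_upwards [h] with m hm
  gcongr

theorem le_limitDensity {X : ∀ m, Finset (V m)} {c : ℝ}
    (h : ∀ᶠ m in (U : Filter ℕ), c ≤ ((X m).card : ℝ) / Fintype.card (V m)) :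
    c ≤ limitDensity U X :=
  ge_of_tendsto (tendsto_limitDensity U X) h

theorem eventually_lt_card_div {X : ∀ m, Finset (V m)} {c : ℝ} (h : c < limitDensity U X) :
    ∀ᶠ m in (U : Filter ℕ), c < ((X m).card : ℝ) / Fintype.card (V m) :=
  (tendsto_limitDensity U X).eventually_const_lt h

theorem eventually_card_div_lt {X : ∀ m, Finset (V m)} {c : ℝ} (h : limitDensity U X < c) :
    ∀ᶠ m in (U : Filter ℕ), ((X m).card : ℝ) / Fintype.card (V m) < c :=
  (tendsto_limitDensity U X).eventually_lt_const h

theorem eventually_nonempty {X : ∀ m, Finset (V m)} (h : 0 < limitDensity U X) :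
    ∀ᶠ m in (U : Filter ℕ), (X m).Nonempty := by
  filter_upwards [eventually_lt_card_div h] with m hm
  by_contra hX
  simp [Finset.not_nonempty_iff_eq_empty.1 hX] at hm

theorem limitDensity_sdiff_add [∀ m, DecidableEq (V m)] {X Y : ∀ m, Finset (V m)}
    (h : ∀ m, X m ⊆ Y m) :
    limitDensity U (fun m => Y m \ X m) + limitDensity U X = limitDensity U Y := by
  refine tendsto_nhds_unique
    ((tendsto_limitDensity U fun m => Y m \ X m).add (tendsto_limitDensity U X)) ?_
  refine (tendsto_limitDensity U Y).congr fun m => ?_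
  rw [← add_div, ← Finset.card_sdiff_add_card_eq_card (h m)]
  push_cast
  rfl

end LimitDensity

/-! ### Atoms from stability. -/

section Atoms

variable {V : ℕ → Type*} (G : ∀ m, SimpleGraph (V m)) [∀ m, DecidableRel (G m).Adj]

/-- The vertices of `X` adjacent (if `τ`) or nonadjacent (if not) to `b`. -/
def adjPart (b : ∀ m, V m) (τ : Bool) (X : ∀ m, Finset (V m)) : ∀ m, Finset (V m) :=
  fun m => {a ∈ X m | (G m).Adj a (b m) ↔ τ = true}

variable {G} in
theorem adjPart_subset (b : ∀ m, V m) (τ : Bool) (X : ∀ m, Finset (V m)) (m : ℕ) :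
    adjPart G b τ X m ⊆ X m :=
  Finset.filter_subset _ _

variable [∀ m, Fintype (V m)] (U : Ultrafilter ℕ)

/-- `b` splits `X` if it is adjacent and nonadjacent to a positive proportion of `X`. -/
def Splits (b : ∀ m, V m) (X : ∀ m, Finset (V m)) : Prop :=
  ∀ τ, 0 < limitDensity U (adjPart G b τ X)

/-- A sequence of sets of positive limit density that is split by no sequence of vertices. -/
def IsLimitAtom (X : ∀ m, Finset (V m)) : Prop :=
  0 < limitDensity U X ∧ ∀ b, ¬ Splits G U b X

/-- Every part of `X` of positive limit density is split by an element of `Q`. -/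
def HereditarilySplit (Q : Set (∀ m, V m)) (X : ∀ m, Finset (V m)) : Prop :=
  ∀ Y : ∀ m, Finset (V m), (∀ᶠ m in (U : Filter ℕ), Y m ⊆ X m) → 0 < limitDensity U Y →
    ∃ b ∈ Q, Splits G U b Y

variable {G U}

theorem Splits.mono {b : ∀ m, V m} {X Y : ∀ m, Finset (V m)}
    (h : ∀ᶠ m in (U : Filter ℕ), X m ⊆ Y m) (hX : Splits G U b X) : Splits G U b Y := fun τ =>
  (hX τ).trans_le <| limitDensity_mono <| h.mono fun _ hm => Finset.filter_subset_filter _ hm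

theorem HereditarilySplit.mono {Q : Set (∀ m, V m)} {X Y : ∀ m, Finset (V m)}
    (h : ∀ᶠ m in (U : Filter ℕ), X m ⊆ Y m) (hY : HereditarilySplit G U Q Y) :
    HereditarilySplit G U Q X := fun Z hZ =>
  hY Z (by filter_upwards [h, hZ] with m h₁ h₂ using h₂.trans h₁)

/-- If `P` fails, some positive part of `X` is split by nothing in `P`. The same then holds for all
its subsets, so there `Q` does all the splitting. -/
theorem HereditarilySplit.exists_of_union {P Q : Set (∀ m, V m)} {X : ∀ m, Finset (V m)}
    (h : HereditarilySplit G U (P ∪ Q) X) (hX : 0 < limitDensity U X) :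
    ∃ Y : ∀ m, Finset (V m), (∀ᶠ m in (U : Filter ℕ), Y m ⊆ X m) ∧ 0 < limitDensity U Y ∧
      (HereditarilySplit G U P Y ∨ HereditarilySplit G U Q Y) := by
  by_cases hP : HereditarilySplit G U P X
  · exact ⟨X, Eventually.of_forall fun _ => subset_rfl, hX, Or.inl hP⟩
  · simp only [HereditarilySplit, not_forall, not_exists, not_and] at hP
    obtain ⟨Y, hYX, hY, hPY⟩ := hP
    refine ⟨Y, hYX, hY, Or.inr fun Z hZY hZ => ?_⟩
    obtain ⟨b, hb | hb, hs⟩ := h.mono hYX Z hZY hZ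
    · exact absurd (hs.mono hZY) (hPY b hb)
    · exact ⟨b, hb, hs⟩

/-- In each initial step of the pattern, `a i` has the same adjacency `t i` to all `b j` with
`i ≤ j`, and `b j` has the opposite adjacency `¬ t j` to all `a i` with `j < i`. -/
theorem HereditarilySplit.exists_pattern (n : ℕ) : ∀ {Q : Set (∀ m, V m)}
    {X : ∀ m, Finset (V m)}, HereditarilySplit G U Q X → 0 < limitDensity U X →
    ∃ (t : Fin n → Bool) (a b : Fin n → ∀ m, V m),
      (∀ i, ∀ᶠ m in (U : Filter ℕ), a i m ∈ X m) ∧ (∀ j, b j ∈ Q) ∧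
      ∀ i j, ∀ᶠ m in (U : Filter ℕ),
        ((G m).Adj (a i m) (b j m) ↔ (if i ≤ j then t i else !t j) = true) := by
  induction n with
  | zero => exact fun _ _ => ⟨finZeroElim, finZeroElim, finZeroElim, finZeroElim, finZeroElim,
      finZeroElim⟩
  | succ n ih =>
    intro Q X hQ hX
    obtain ⟨b₀, -, -⟩ := hQ X (Eventually.of_forall fun _ => subset_rfl) hX
    obtain ⟨a, ha⟩ : ∃ a : ∀ m, V m, ∀ᶠ m in (U : Filter ℕ), a m ∈ X m := by
      have : ∀ m, ∃ x, (X m).Nonempty → x ∈ X m := fun m => by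
        by_cases h : (X m).Nonempty
        · exact ⟨h.choose, fun _ => h.choose_spec⟩
        · exact ⟨b₀ m, fun h' => absurd h' h⟩
      choose a ha using this
      exact ⟨a, (eventually_nonempty hX).mono ha⟩
    -- The ultrafilter divides `Q` by adjacency to `a`. One class still splits hereditarily on some
    -- `Y`, which fixes the adjacency of `a` to every later `b`.
    obtain ⟨τ, Y, hYX, hY, hQY⟩ : ∃ (τ : Bool) (Y : ∀ m, Finset (V m)),
        (∀ᶠ m in (U : Filter ℕ), Y m ⊆ X m) ∧ 0 < limitDensity U Y ∧ HereditarilySplit G U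
          {b ∈ Q | ∀ᶠ m in (U : Filter ℕ), ((G m).Adj (a m) (b m) ↔ τ = true)} Y := by
      have hQ' : Q = {b ∈ Q | ∀ᶠ m in (U : Filter ℕ), ((G m).Adj (a m) (b m) ↔ true = true)} ∪
          {b ∈ Q | ∀ᶠ m in (U : Filter ℕ), ((G m).Adj (a m) (b m) ↔ false = true)} := by
        ext b
        have := Ultrafilter.em U fun m => (G m).Adj (a m) (b m)
        simp only [Set.mem_union, Set.mem_ofPred_eq, iff_true, Bool.false_eq_true, iff_false]
        tauto
      rw [hQ'] at hQ
      obtain ⟨Y, hYX, hY, h | h⟩ := hQ.exists_of_union hX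
      exacts [⟨true, Y, hYX, hY, h⟩, ⟨false, Y, hYX, hY, h⟩]
    obtain ⟨b, hbQ, hb⟩ := hQY Y (Eventually.of_forall fun _ => subset_rfl) hY
    -- Since `b` splits `Y`, the part with adjacency `!τ` to `b` has positive density; all later `a`
    -- are taken there.
    obtain ⟨t, a', b', ha', hb', hab⟩ :=
      ih (hQY.mono (Eventually.of_forall (adjPart_subset b (!τ) Y))) (hb (!τ))
    refine ⟨Fin.cons τ t, Fin.cons a a', Fin.cons b b', ?_, ?_, ?_⟩
    · refine Fin.cases ha fun i => ?_
      filter_upwards [ha' i, hYX] with m h₁ h₂ using h₂ (adjPart_subset _ _ _ _ h₁)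
    · exact Fin.cases hbQ.1 fun j => (hb' j).1
    · refine Fin.cases (Fin.cases ?_ fun j => ?_) fun i => Fin.cases ?_ fun j => ?_
      · simpa using hbQ.2
      · simpa using (hb' j).2
      · filter_upwards [ha' i] with m hm
        simpa using (Finset.mem_filter.1 hm).2
      · simpa using hab i j

/-- Among `2k + 1` indices, `k + 1` share the same value of `t`, and on these the pattern is a
half-graph or its complement. Reversing the order turns the complement into a half-graph with a
strict inequality; the extra index allows the shift that makes it weak. -/
theorem not_isStable_of_pattern {W : Type*} (H : SimpleGraph W) (k : ℕ)
    (t : Fin (2 * k + 1) → Bool) (a b : Fin (2 * k + 1) → W)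
    (h : ∀ i j, (H.Adj (a i) (b j) ↔ (if i ≤ j then t i else !t j) = true)) :
    ¬ H.IsStable k := by
  obtain ⟨τ, hτ⟩ : ∃ τ : Bool, k < (Finset.univ.filter fun i => t i = τ).card := by
    obtain ⟨τ, -, hτ⟩ := Finset.exists_lt_card_fiber_of_mul_lt_card_of_maps_to
      (s := (Finset.univ : Finset (Fin (2 * k + 1)))) (t := (Finset.univ : Finset Bool)) (f := t)
      (n := k) (fun _ _ => Finset.mem_univ _) (by simp)
    exact ⟨τ, hτ⟩
  obtain ⟨s, hs, hsc⟩ := Finset.exists_subset_card_eq (Nat.succ_le_of_lt hτ)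
  have ht : ∀ i, t (s.orderEmbOfFin hsc i) = τ := fun i =>
    (Finset.mem_filter.1 (hs (Finset.orderEmbOfFin_mem s hsc i))).2
  rw [SimpleGraph.IsStable, not_not]
  set e := s.orderEmbOfFin hsc
  cases τ with
  | true =>
    refine ⟨fun i => a (e i.castSucc), fun j => b (e j.castSucc), fun i j => ?_⟩
    rw [h, ht, ht]
    simp [e]
  | false =>
    refine ⟨fun i => a (e i.castSucc.rev), fun j => b (e j.succ.rev), fun i j => ?_⟩
    have hle : e i.castSucc.rev ≤ e j.succ.rev ↔ ¬ i ≤ j := by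
      rw [e.le_iff_le, Fin.rev_le_rev, Fin.succ_le_castSucc_iff, not_le]
    rw [h, ht, ht]
    simp [hle]

theorem exists_isLimitAtom {k : ℕ} (hG : ∀ m, (G m).IsStable k) {X : ∀ m, Finset (V m)}
    (hX : 0 < limitDensity U X) :
    ∃ Y : ∀ m, Finset (V m), (∀ᶠ m in (U : Filter ℕ), Y m ⊆ X m) ∧ IsLimitAtom G U Y := by
  by_contra hno
  have hs : HereditarilySplit G U Set.univ X := fun Y hYX hY => by
    by_contra hb
    exact hno ⟨Y, hYX, hY, fun b hb' => hb ⟨b, Set.mem_univ b, hb'⟩⟩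
  obtain ⟨t, a, b, -, -, hab⟩ := hs.exists_pattern (2 * k + 1) hX
  obtain ⟨m, hm⟩ := (eventually_all.2 fun i => eventually_all.2 (hab i)).exists
  exact not_isStable_of_pattern (G m) k t (fun i => a i m) (fun j => b j m) hm (hG m)

end Atoms

/-! ### Exhausting almost everything by atoms. -/

section Exhaustion

variable {V : ℕ → Type*} [∀ m, Fintype (V m)]
  {G : ∀ m, SimpleGraph (V m)} [∀ m, DecidableRel (G m).Adj] {U : Ultrafilter ℕ}

theorem IsLimitAtom.congr {X Y : ∀ m, Finset (V m)} (hX : IsLimitAtom G U X)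
    (h : ∀ᶠ m in (U : Filter ℕ), X m = Y m) : IsLimitAtom G U Y :=
  ⟨hX.1.trans_le (limitDensity_mono (h.mono fun _ hm => hm.subset)), fun b hb =>
    hX.2 b (hb.mono (h.mono fun _ hm => hm.symm.subset))⟩

/-- A set of positive limit density contains an atom of almost the largest possible density. -/
theorem exists_large_isLimitAtom [∀ m, DecidableEq (V m)] {k : ℕ} (hG : ∀ m, (G m).IsStable k)
    {X : ∀ m, Finset (V m)} (hX : 0 < limitDensity U X) :
    ∃ Y : ∀ m, Finset (V m), (∀ m, Y m ⊆ X m) ∧ IsLimitAtom G U Y ∧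
      ∀ Z : ∀ m, Finset (V m), (∀ᶠ m in (U : Filter ℕ), Z m ⊆ X m) → IsLimitAtom G U Z →
        limitDensity U Z ≤ 2 * limitDensity U Y := by
  set S := {c | ∃ Y : ∀ m, Finset (V m), (∀ᶠ m in (U : Filter ℕ), Y m ⊆ X m) ∧
    IsLimitAtom G U Y ∧ limitDensity U Y = c} with hS
  have hbdd : BddAbove S := ⟨1, by rintro _ ⟨Y, -, -, rfl⟩; exact limitDensity_le_one Y⟩
  obtain ⟨Y₀, hY₀X, hY₀⟩ := exists_isLimitAtom hG hX
  have hmem : limitDensity U Y₀ ∈ S := ⟨Y₀, hY₀X, hY₀, rfl⟩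
  have hpos : 0 < sSup S := hY₀.1.trans_le (le_csSup hbdd hmem)
  obtain ⟨_, ⟨Y, hYX, hY, rfl⟩, hlt⟩ := exists_lt_of_lt_csSup ⟨_, hmem⟩ (half_lt_self hpos)
  have heq : ∀ᶠ m in (U : Filter ℕ), Y m = Y m ∩ X m :=
    hYX.mono fun m hm => (Finset.inter_eq_left.2 hm).symm
  refine ⟨fun m => Y m ∩ X m, fun m => Finset.inter_subset_right, hY.congr heq, fun Z hZX hZ => ?_⟩
  have h₁ : limitDensity U Z ≤ sSup S := le_csSup hbdd ⟨Z, hZX, hZ, rfl⟩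
  have h₂ : limitDensity U Y ≤ limitDensity U fun m => Y m ∩ X m :=
    limitDensity_mono (heq.mono fun _ hm => hm.subset)
  linarith

/-- Countable saturation for decreasing sequences of sets of density bounded below. -/
theorem exists_subset_of_antitone (hU : (U : Filter ℕ) ≤ atTop) {R : ℕ → ∀ m, Finset (V m)}
    (hR : ∀ m, Antitone fun n => R n m) {c : ℝ} (hc : ∀ n, c < limitDensity U (R n)) :
    ∃ X : ∀ m, Finset (V m), c ≤ limitDensity U X ∧
      ∀ n, ∀ᶠ m in (U : Filter ℕ), X m ⊆ R n m := by
  classical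
  -- Diagonal choice: at `m`, take the last `R n m` with `n ≤ m` whose density still exceeds `c`.
  let p : ∀ _ : ℕ, ℕ → Prop := fun m n => c < ((R n m).card : ℝ) / Fintype.card (V m)
  refine ⟨fun m => R (Nat.findGreatest (p m) m) m, le_limitDensity ?_, fun n => ?_⟩
  · filter_upwards [eventually_lt_card_div (hc 0)] with m hm
    exact (Nat.findGreatest_spec (P := p m) (Nat.zero_le m) hm).le
  · filter_upwards [eventually_lt_card_div (hc n), hU (eventually_ge_atTop n)] with m hm hnm
    exact hR m (Nat.le_findGreatest (P := p m) hnm hm)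

theorem exists_isLimitAtom_family [∀ m, DecidableEq (V m)] {k : ℕ}
    (hU : (U : Filter ℕ) ≤ atTop) (hG : ∀ m, (G m).IsStable k) {ε : ℝ} (hε : 0 < ε) :
    ∃ (r : ℕ) (A : Fin r → ∀ m, Finset (V m)), (∀ i, IsLimitAtom G U (A i)) ∧
      limitDensity U (fun m => Finset.univ \ Finset.univ.biUnion fun i => A i m) ≤ ε := by
  have hex : ∀ X : ∀ m, Finset (V m), ∃ Y : ∀ m, Finset (V m), (∀ m, Y m ⊆ X m) ∧
      (0 < limitDensity U X → IsLimitAtom G U Y ∧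
        ∀ Z : ∀ m, Finset (V m), (∀ᶠ m in (U : Filter ℕ), Z m ⊆ X m) → IsLimitAtom G U Z →
          limitDensity U Z ≤ 2 * limitDensity U Y) := fun X => by
    by_cases hX : 0 < limitDensity U X
    · obtain ⟨Y, h₁, h₂⟩ := exists_large_isLimitAtom hG hX
      exact ⟨Y, h₁, fun _ => h₂⟩
    · exact ⟨X, fun _ => subset_rfl, fun h => absurd h hX⟩
  choose pick hpick hatom using hex
  let R : ℕ → ∀ m, Finset (V m) := fun n =>
    Nat.rec (fun _ => Finset.univ) (fun _ X m => X m \ pick X m) n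
  have hRs : ∀ n m, R (n + 1) m = R n m \ pick (R n) m := fun _ _ => rfl
  by_cases hn : ∃ n, limitDensity U (R n) ≤ ε ∧ ∀ i < n, ε < limitDensity U (R i)
  · obtain ⟨n, hn, hlt⟩ := hn
    refine ⟨n, fun i => pick (R i), fun i => (hatom _ (hε.trans (hlt i i.2))).1, ?_⟩
    have key : ∀ n m, (Finset.univ \ Finset.univ.biUnion fun i : Fin n => pick (R i) m) = R n m := by
      intro n m
      induction n with
      | zero => simp [R]
      | succ n ih =>
        rw [hRs, ← ih]
        ext x
        simp [Fin.exists_fin_succ']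
    simpa only [key] using hn
  -- If the process never stops, an atom `Z` lies in all remainders, so each removed atom has at
  -- least half its density, and the total would exceed 1.
  · exfalso
    have hR : ∀ n, ε < limitDensity U (R n) := fun n => by
      induction n using Nat.strong_induction_on with
      | _ n ih =>
        by_contra h
        exact hn ⟨n, not_lt.1 h, ih⟩
    obtain ⟨X, hX, hXR⟩ := exists_subset_of_antitone hU
      (fun m => antitone_nat_of_succ_le fun n => by rw [hRs]; exact Finset.sdiff_subset) hR
    obtain ⟨Z, hZX, hZ⟩ := exists_isLimitAtom hG (hε.trans_le hX)
    have hbound : ∀ n : ℕ, limitDensity U (R n) ≤ 1 - n * (limitDensity U Z / 2) := fun n => by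
      induction n with
      | zero => simpa using limitDensity_le_one (R 0)
      | succ n ih =>
        have h₁ := limitDensity_sdiff_add (U := U) (hpick (R n))
        have h₂ := (hatom (R n) (hε.trans (hR n))).2 Z
          (by filter_upwards [hZX, hXR n] with m h h' using h.trans h') hZ
        have h₃ : limitDensity U (R (n + 1)) =
          limitDensity U fun m => R n m \ pick (R n) m := rfl
        push_cast
        linarith
    obtain ⟨n, hn⟩ := exists_nat_gt (1 / (limitDensity U Z / 2))
    rw [div_lt_iff₀ (half_pos hZ.1)] at hn
    linarith [hbound n, limitDensity_nonneg (U := U) (R n)]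

/-- Bad vertices for ultrafilter-many `m` would assemble into one sequence splitting `X`. -/
theorem IsLimitAtom.eventually_good [∀ m, Nonempty (V m)] {X : ∀ m, Finset (V m)}
    (hX : IsLimitAtom G U X) {δ : ℝ} (hδ : 0 < δ) :
    ∀ᶠ m in (U : Filter ℕ), ∀ b : V m,
      (({a ∈ X m | (G m).Adj a b}.card : ℕ) : ℝ) ≤ δ * Fintype.card (V m) ∨
      (({a ∈ X m | ¬ (G m).Adj a b}.card : ℕ) : ℝ) ≤ δ * Fintype.card (V m) := by
  by_contra h
  rw [← Ultrafilter.eventually_not] at h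
  have hb : ∀ m, ∃ b : V m, (¬ ∀ b : V m,
      (({a ∈ X m | (G m).Adj a b}.card : ℕ) : ℝ) ≤ δ * Fintype.card (V m) ∨
      (({a ∈ X m | ¬ (G m).Adj a b}.card : ℕ) : ℝ) ≤ δ * Fintype.card (V m)) →
      δ * Fintype.card (V m) < (({a ∈ X m | (G m).Adj a b}.card : ℕ) : ℝ) ∧
      δ * Fintype.card (V m) < (({a ∈ X m | ¬ (G m).Adj a b}.card : ℕ) : ℝ) := fun m => by
    by_cases h : ∀ b : V m,
      (({a ∈ X m | (G m).Adj a b}.card : ℕ) : ℝ) ≤ δ * Fintype.card (V m) ∨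
      (({a ∈ X m | ¬ (G m).Adj a b}.card : ℕ) : ℝ) ≤ δ * Fintype.card (V m)
    · exact ⟨Classical.arbitrary _, fun h' => absurd h h'⟩
    · obtain ⟨b, hb⟩ := not_forall.1 h
      exact ⟨b, fun _ => by simpa only [not_or, not_le] using hb⟩
  choose b hb using hb
  refine hX.2 b fun τ => hδ.trans_le (le_limitDensity ?_)
  filter_upwards [h] with m hm
  have hpos : (0 : ℝ) < Fintype.card (V m) := by exact_mod_cast Fintype.card_pos
  rw [le_div_iff₀ hpos]
  cases τ with
  | true => simpa [adjPart] using (hb m hm).1.le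
  | false => simpa [adjPart] using (hb m hm).2.le

end Exhaustion

/-! ### Almost constant rows and columns force homogeneity. -/

section Homogeneous

variable {α β : Type*}

theorem cast_card_interedges_eq_sum (r : α → β → Prop) [∀ a, DecidablePred (r a)]
    (A : Finset α) (B : Finset β) :
    ((Rel.interedges r A B).card : ℝ) = ∑ b ∈ B, (({a ∈ A | r a b}.card : ℕ) : ℝ) := by
  rw [Rel.interedges, Finset.card_filter, Finset.sum_product_right]
  simp

theorem card_interedges_le_of_few_large (r : α → β → Prop) [∀ a, DecidablePred (r a)]
    (A : Finset α) (B : Finset β) {N δ θ : ℝ} (hN : 0 ≤ N) (hδ : 0 ≤ δ) (hA : A.card ≤ N)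
    (hB : B.card ≤ N)
    (h : ({b ∈ B | δ * N < (({a ∈ A | r a b}.card : ℕ) : ℝ)}.card : ℝ) ≤ θ * N) :
    ((Rel.interedges r A B).card : ℝ) ≤ (θ + δ) * N ^ 2 := by
  rw [cast_card_interedges_eq_sum,
    ← Finset.sum_filter_add_sum_filter_not B fun b => δ * N < (({a ∈ A | r a b}.card : ℕ) : ℝ)]
  have h₁ := Finset.sum_le_card_nsmul {b ∈ B | δ * N < (({a ∈ A | r a b}.card : ℕ) : ℝ)}
    (fun b => (({a ∈ A | r a b}.card : ℕ) : ℝ)) N fun b _ =>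
      le_trans (by exact_mod_cast Finset.card_filter_le _ _) hA
  have h₂ := Finset.sum_le_card_nsmul {b ∈ B | ¬ δ * N < (({a ∈ A | r a b}.card : ℕ) : ℝ)}
    (fun b => (({a ∈ A | r a b}.card : ℕ) : ℝ)) (δ * N) fun b hb =>
      not_lt.1 (Finset.mem_filter.1 hb).2
  have h₃ : ({b ∈ B | ¬ δ * N < (({a ∈ A | r a b}.card : ℕ) : ℝ)}.card : ℝ) ≤ N :=
    le_trans (by exact_mod_cast Finset.card_filter_le _ _) hB
  rw [nsmul_eq_mul] at h₁ h₂
  have h₄ := mul_le_mul_of_nonneg_right h hN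
  have h₅ := mul_le_mul_of_nonneg_right h₃ (mul_nonneg hδ hN)
  nlinarith

/-- If all rows and all columns of a relation are almost constant, then so is the relation. -/
theorem card_interedges_le_or_card_interedges_compl_le (r : α → β → Prop) [DecidableRel r]
    (A : Finset α) (B : Finset β) {N c δ θ : ℝ} (hN : 0 < N) (hδ : 0 < δ) (hθ : 0 < θ)
    (hcδ : 4 * δ ≤ c) (hcθ : 2 * δ ≤ c * θ ^ 2) (hA : A.card ≤ N) (hB : B.card ≤ N)
    (hcA : c * N ≤ A.card)
    (hrow : ∀ b ∈ B, (({a ∈ A | r a b}.card : ℕ) : ℝ) ≤ δ * N ∨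
      (({a ∈ A | ¬ r a b}.card : ℕ) : ℝ) ≤ δ * N)
    (hcol : ∀ a ∈ A, (({b ∈ B | r a b}.card : ℕ) : ℝ) ≤ δ * N ∨
      (({b ∈ B | ¬ r a b}.card : ℕ) : ℝ) ≤ δ * N) :
    ((Rel.interedges r A B).card : ℝ) ≤ (θ + δ) * N ^ 2 ∨
      ((Rel.interedges (fun a b => ¬ r a b) A B).card : ℝ) ≤ (θ + δ) * N ^ 2 := by
  set D := {b ∈ B | δ * N < (({a ∈ A | r a b}.card : ℕ) : ℝ)} with hD
  set D' := {b ∈ B | δ * N < (({a ∈ A | ¬ r a b}.card : ℕ) : ℝ)} with hD'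
  rcases le_or_gt (D.card : ℝ) (θ * N) with h | h
  · exact Or.inl (card_interedges_le_of_few_large r A B hN.le hδ.le hA hB h)
  rcases le_or_gt (D'.card : ℝ) (θ * N) with h' | h'
  · exact Or.inr (card_interedges_le_of_few_large _ A B hN.le hδ.le hA hB h')
  exfalso
  -- Count triples with `a` related to `b` but not to `b'`. The row of `b` misses at most `δN` of
  -- `A` and the row of `b'` meets at most `δN`, leaving at least `(c - 2δ)N ≥ cN/2` choices of `a`.
  have hlow : (D.card * D'.card : ℝ) * (c / 2 * N) ≤
      ∑ b ∈ D, ∑ b' ∈ D', ∑ a ∈ A, (if r a b then (1 : ℝ) else 0) * if ¬ r a b' then 1 else 0 := by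
    rw [mul_assoc, ← nsmul_eq_mul, ← nsmul_eq_mul]
    refine Finset.card_nsmul_le_sum _ _ _ fun b hb => Finset.card_nsmul_le_sum _ _ _ fun b' hb' => ?_
    obtain ⟨hbB, hb⟩ := Finset.mem_filter.1 hb
    obtain ⟨hbB', hb'⟩ := Finset.mem_filter.1 hb'
    have h₁ := (hrow b hbB).resolve_left hb.not_ge
    have h₂ := (hrow b' hbB').resolve_right hb'.not_ge
    have h₃ : (A.card : ℝ) = (({a ∈ A | r a b}.card : ℕ) : ℝ) + ({a ∈ A | ¬ r a b}.card : ℕ) := by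
      exact_mod_cast (Finset.card_filter_add_card_filter_not (s := A) fun a => r a b).symm
    have h₄ : (({a ∈ A | r a b}.card : ℕ) : ℝ) - ({a ∈ A | r a b'}.card : ℕ) ≤
        ∑ a ∈ A, (if r a b then (1 : ℝ) else 0) * if ¬ r a b' then 1 else 0 := by
      rw [Finset.card_filter, Finset.card_filter]
      push_cast
      rw [← Finset.sum_sub_distrib]
      refine Finset.sum_le_sum fun a _ => ?_
      split_ifs <;> norm_num
    nlinarith
  -- For fixed `a`, the column condition bounds one of the two factors by `δN`, and the other is at
  -- most `N`.
  have hup : ∑ b ∈ D, ∑ b' ∈ D', ∑ a ∈ A,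
      (if r a b then (1 : ℝ) else 0) * (if ¬ r a b' then 1 else 0) ≤ N * (δ * N * N) := by
    have hswap : ∑ b ∈ D, ∑ b' ∈ D', ∑ a ∈ A,
        (if r a b then (1 : ℝ) else 0) * (if ¬ r a b' then 1 else 0) =
        ∑ a ∈ A, (({b ∈ D | r a b}.card : ℕ) : ℝ) * ({b ∈ D' | ¬ r a b}.card : ℕ) := by
      simp_rw [Finset.card_filter]
      push_cast
      simp_rw [Finset.sum_mul_sum]
      rw [Finset.sum_comm]
      simp_rw [Finset.sum_comm (s := D) (t := A), Finset.sum_comm (s := D') (t := A)]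
      exact Finset.sum_congr rfl fun _ _ => Finset.sum_comm
    rw [hswap]
    refine (Finset.sum_le_card_nsmul A _ (δ * N * N) fun a ha => ?_).trans ?_
    · have h₁ : (({b ∈ D | r a b}.card : ℕ) : ℝ) ≤ ({b ∈ B | r a b}.card : ℕ) := by
        exact_mod_cast Finset.card_le_card (Finset.filter_subset_filter _ (Finset.filter_subset _ _))
      have h₂ : (({b ∈ D' | ¬ r a b}.card : ℕ) : ℝ) ≤ ({b ∈ B | ¬ r a b}.card : ℕ) := by
        exact_mod_cast Finset.card_le_card (Finset.filter_subset_filter _ (Finset.filter_subset _ _))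
      have h₃ : (({b ∈ B | r a b}.card : ℕ) : ℝ) ≤ N :=
        le_trans (by exact_mod_cast Finset.card_filter_le _ _) hB
      have h₄ : (({b ∈ B | ¬ r a b}.card : ℕ) : ℝ) ≤ N :=
        le_trans (by exact_mod_cast Finset.card_filter_le _ _) hB
      rcases hcol a ha with h | h
      · exact mul_le_mul (h₁.trans h) (h₂.trans h₄) (by positivity) (by positivity)
      · rw [mul_comm]
        exact mul_le_mul (h₂.trans h) (h₁.trans h₃) (by positivity) (by positivity)
    · rw [nsmul_eq_mul]
      gcongr
  have hDD : θ * N * (θ * N) < D.card * D'.card := by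
    have : 0 < θ * N := by positivity
    exact mul_lt_mul'' h h' this.le this.le
  have hc : 0 < c / 2 * N := by nlinarith
  have h₁ := (mul_lt_mul_of_pos_right hDD hc).trans_le (hlow.trans hup)
  have h₂ : 0 ≤ (c * θ ^ 2 - 2 * δ) * N ^ 3 := mul_nonneg (by linarith) (by positivity)
  nlinarith

end Homogeneous

/-! ### Cutting into pieces of equal size. -/

section EqualPieces

variable {V : Type*} [Fintype V] [DecidableEq V]

/-- A family of sets can be cut into disjoint pieces of size `s`, up to fewer than `s` elements of
each set. -/
theorem exists_disjoint_pieces {ι : Type*} (A : ι → Finset V) {s : ℕ} (hs : 0 < s) :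
    ∃ P : Finset (Finset V), (P : Set (Finset V)).PairwiseDisjoint id ∧
      (∀ p ∈ P, p.card = s ∧ ∃ i, p ⊆ A i) ∧ ∀ i, (A i \ P.biUnion id).card < s := by
  classical
  obtain ⟨P, hP⟩ := Set.Finite.exists_maximal (s := {P : Finset (Finset V) |
    (P : Set (Finset V)).PairwiseDisjoint id ∧ ∀ p ∈ P, p.card = s ∧ ∃ i, p ⊆ A i})
    (Set.toFinite _) ⟨∅, by simp⟩
  refine ⟨P, hP.1.1, hP.1.2, fun i => ?_⟩
  by_contra! h
  obtain ⟨q, hq, hqs⟩ := Finset.exists_subset_card_eq h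
  have hdisj : ∀ p ∈ P, Disjoint q p := fun p hp => Finset.disjoint_left.2 fun x hx hxp =>
    (Finset.mem_sdiff.1 (hq hx)).2 (Finset.mem_biUnion.2 ⟨p, hp, hxp⟩)
  -- Maximality forces `q` into `P`; but `q` is disjoint from every member of `P`, hence from
  -- itself.
  have hmem : q ∈ P := by
    refine hP.2 (y := insert q P) ⟨?_, ?_⟩ (Finset.subset_insert _ _) (Finset.mem_insert_self _ _)
    · rw [Finset.coe_insert]
      exact hP.1.1.insert fun p hp _ => hdisj p hp
    · intro p hp
      obtain rfl | hp := Finset.mem_insert.1 hp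
      · exact ⟨hqs, i, hq.trans Finset.sdiff_subset⟩
      · exact hP.1.2 p hp
  have := hdisj q hmem
  rw [disjoint_self, Finset.bot_eq_empty] at this
  simp [this] at hqs
  omega

theorem exists_isPartitionWithExceptionalSet (P : Finset (Finset V))
    (hP : (P : Set (Finset V)).PairwiseDisjoint id) (hne : ∀ p ∈ P, p.Nonempty) :
    ∃ Y : Fin (P.card + 1) → Finset V, IsPartitionWithExceptionalSet Y ∧
      Y 0 = Finset.univ \ P.biUnion id ∧ ∀ i, i ≠ 0 → Y i ∈ P := by
  have hmem : ∀ i : Fin P.card, ((P.equivFin.symm i : P) : Finset V) ∈ P := fun i =>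
    (P.equivFin.symm i).2
  have hdisj : ∀ p ∈ P, Disjoint (Finset.univ \ P.biUnion id) p := fun p hp =>
    Finset.disjoint_left.2 fun x hx hxp =>
      (Finset.mem_sdiff.1 hx).2 (Finset.mem_biUnion.2 ⟨p, hp, hxp⟩)
  refine ⟨Fin.cons (Finset.univ \ P.biUnion id) fun i => P.equivFin.symm i, ⟨?_, ?_, ?_⟩, rfl, ?_⟩
  · refine Fin.cases (Fin.cases (fun h => absurd rfl h) fun j _ => ?_)
      fun i => Fin.cases (fun _ => ?_) fun j hij => ?_
    · exact hdisj _ (hmem j)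
    · exact (hdisj _ (hmem i)).symm
    · refine hP (hmem i) (hmem j) fun h => hij ?_
      rw [P.equivFin.symm.injective (Subtype.ext h)]
  · intro v
    by_cases hv : v ∈ P.biUnion id
    · obtain ⟨p, hp, hvp⟩ := Finset.mem_biUnion.1 hv
      refine ⟨(P.equivFin ⟨p, hp⟩).succ, ?_⟩
      simpa using hvp
    · exact ⟨0, by simpa using hv⟩
  · exact Fin.cases (fun h => absurd rfl h) fun i _ => hne _ (hmem i)
  · exact Fin.cases (fun h => absurd rfl h) fun i _ => hmem i

theorem edgeDensity_lt_of_subset {W : Type*} (r : W → W → Prop) [DecidableRel r]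
    {A B p q : Finset W} (hp : p ⊆ A) (hq : q ⊆ B) {x y N : ℝ} (hx : 0 < x)
    (hpx : x ≤ p.card) (hqx : x ≤ q.card) (h : ((Rel.interedges r A B).card : ℝ) ≤ N)
    (hN : N < y * x ^ 2) (hy : 0 ≤ y) : (Rel.edgeDensity r p q : ℝ) < y := by
  rw [Rel.edgeDensity]
  push_cast
  rw [div_lt_iff₀ (mul_pos (hx.trans_le hpx) (hx.trans_le hqx))]
  have h₁ : ((Rel.interedges r p q).card : ℝ) ≤ (Rel.interedges r A B).card := by
    exact_mod_cast Finset.card_le_card (Rel.interedges_mono hp hq)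
  have h₂ : x ^ 2 ≤ (p.card : ℝ) * q.card := by
    rw [sq]
    exact mul_le_mul hpx hqx hx.le (by positivity)
  nlinarith [mul_le_mul_of_nonneg_left h₂ hy]

/-- Pieces have size `⌊γ|V|⌋`, at least `γ|V|/2`, so there are at most `2/γ ≤ M` of them, and
passing to pieces raises the error from `η` to at most `4η/γ²`. The leftovers of the `r` sets total
at most `rγ|V|`. -/
theorem exists_equipartition_of_homogeneous (G : SimpleGraph V) [DecidableRel G.Adj]
    {r M : ℕ} (A : Fin r → Finset V) {γ ε η : ℝ} (σ : ℕ → ℝ) (hγ : 0 < γ)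
    (hγV : 1 ≤ γ * Fintype.card V) (hγr : γ * r ≤ ε / 2)
    (hA : ((Finset.univ \ Finset.univ.biUnion A).card : ℝ) ≤ ε / 2 * Fintype.card V)
    (hη : ∀ i j, ((Rel.interedges G.Adj (A i) (A j)).card : ℝ) ≤ η * (Fintype.card V : ℝ) ^ 2 ∨
      ((Rel.interedges (fun a b => ¬ G.Adj a b) (A i) (A j)).card : ℝ) ≤
        η * (Fintype.card V : ℝ) ^ 2)
    (hM : 2 ≤ γ * M) (hσ : ∀ n ≤ M, 0 ≤ σ n ∧ 4 * η < σ n * γ ^ 2) :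
    ∃ n : ℕ, n ≤ M ∧ ∃ Y : Fin (n + 1) → Finset V,
      IsPartitionWithExceptionalSet Y ∧ ((Y 0).card : ℝ) ≤ ε * (Fintype.card V : ℝ) ∧
      ∀ i j : Fin (n + 1), i ≠ 0 → j ≠ 0 → (Y i).card = (Y j).card ∧
        ((G.edgeDensity (Y i) (Y j) : ℝ) < σ n ∨ 1 - σ n < (G.edgeDensity (Y i) (Y j) : ℝ)) := by
  set N : ℝ := Nat.cast (Fintype.card V)
  set s := ⌊γ * N⌋₊
  have hs : 0 < s := Nat.floor_pos.2 hγV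
  have hsle : (s : ℝ) ≤ γ * N := Nat.floor_le (by linarith)
  have hsge : γ * N / 2 ≤ s := by
    have h₁ : γ * N < s + 1 := Nat.lt_floor_add_one _
    have h₂ : (1 : ℝ) ≤ s := by exact_mod_cast hs
    linarith
  have hN : 0 < N := by
    by_contra h
    nlinarith
  obtain ⟨P, hP, hPs, hPA⟩ := exists_disjoint_pieces A hs
  have hne : ∀ p ∈ P, p.Nonempty := fun p hp => Finset.card_pos.1 (by rw [(hPs p hp).1]; exact hs)
  obtain ⟨Y, hY, hY₀, hYP⟩ := exists_isPartitionWithExceptionalSet P hP hne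
  have hcard : P.card ≤ M := by
    have h₁ : (P.biUnion id).card = P.card * s := by
      rw [Finset.card_biUnion hP]
      exact Finset.sum_const_nat fun p hp => (hPs p hp).1
    have h₂ : (P.card * s : ℝ) ≤ Fintype.card V := by
      exact_mod_cast h₁ ▸ Finset.card_le_univ _
    have h₃ : (P.card : ℝ) * (γ * N / 2) ≤ γ * M / 2 * N := by
      have := mul_le_mul_of_nonneg_left hsge (Nat.cast_nonneg (α := ℝ) P.card)
      nlinarith
    have h₄ : (P.card : ℝ) * (γ * N / 2) ≤ M * (γ * N / 2) := by linarith
    exact_mod_cast le_of_mul_le_mul_right h₄ (by positivity)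
  refine ⟨P.card, hcard, Y, hY, ?_, fun i j hi hj => ⟨?_, ?_⟩⟩
  · have hsub : Y 0 ⊆ (Finset.univ \ Finset.univ.biUnion A) ∪
        Finset.univ.biUnion fun i => A i \ P.biUnion id := fun x hx => by
      rw [hY₀, Finset.mem_sdiff] at hx
      by_cases h : x ∈ Finset.univ.biUnion A
      · obtain ⟨i, -, hi⟩ := Finset.mem_biUnion.1 h
        exact Finset.mem_union_right _ (Finset.mem_biUnion.2
          ⟨i, Finset.mem_univ i, Finset.mem_sdiff.2 ⟨hi, hx.2⟩⟩)
      · exact Finset.mem_union_left _ (Finset.mem_sdiff.2 ⟨Finset.mem_univ x, h⟩)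
    have h₁ : (Finset.univ.biUnion fun i => A i \ P.biUnion id).card ≤ r * s := by
      simpa using Finset.card_biUnion_le_card_mul Finset.univ (fun i => A i \ P.biUnion id) s
        fun i _ => (hPA i).le
    have h₂ : ((Y 0).card : ℝ) ≤ (Finset.univ \ Finset.univ.biUnion A).card + r * s := by
      exact_mod_cast (Finset.card_le_card hsub).trans ((Finset.card_union_le _ _).trans
        (Nat.add_le_add_left h₁ _))
    have h₃ := mul_le_mul_of_nonneg_left hsle (Nat.cast_nonneg (α := ℝ) r)
    have h₄ := mul_le_mul_of_nonneg_right hγr hN.le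
    nlinarith
  · rw [(hPs _ (hYP i hi)).1, (hPs _ (hYP j hj)).1]
  · obtain ⟨hi', a, hia⟩ := hPs _ (hYP i hi)
    obtain ⟨hj', b, hjb⟩ := hPs _ (hYP j hj)
    obtain ⟨hσ₀, hσ⟩ := hσ _ hcard
    have hx : 0 < γ * N / 2 := by positivity
    have hlt : η * N ^ 2 < σ P.card * (γ * N / 2) ^ 2 := by nlinarith [pow_pos hN 2]
    refine (hη a b).imp (fun h => ?_) fun h => ?_
    · exact edgeDensity_lt_of_subset G.Adj hia hjb hx (by rwa [hi']) (by rwa [hj']) h hlt hσ₀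
    · have h₁ := edgeDensity_lt_of_subset _ hia hjb hx (by rwa [hi']) (by rwa [hj']) h hlt hσ₀
      have h₂ : (Rel.edgeDensity G.Adj (Y i) (Y j) : ℝ) +
          Rel.edgeDensity (fun a b => ¬ G.Adj a b) (Y i) (Y j) = 1 := by
        exact_mod_cast Rel.edgeDensity_add_edgeDensity_compl G.Adj (hY.nonempty i hi)
          (hY.nonempty j hj)
      change 1 - σ P.card < (Rel.edgeDensity G.Adj (Y i) (Y j) : ℝ)
      linarith

/-- The partition into singletons. -/
theorem exists_equipartition_card (G : SimpleGraph V) [DecidableRel G.Adj] {ε x : ℝ} (hε : 0 < ε)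
    (hx : 0 < x) :
    ∃ Y : Fin (Fintype.card V + 1) → Finset V,
      IsPartitionWithExceptionalSet Y ∧ ((Y 0).card : ℝ) ≤ ε * (Fintype.card V : ℝ) ∧
      ∀ i j, i ≠ 0 → j ≠ 0 → (Y i).card = (Y j).card ∧
        ((G.edgeDensity (Y i) (Y j) : ℝ) < x ∨ 1 - x < (G.edgeDensity (Y i) (Y j) : ℝ)) := by
  let P : Finset (Finset V) := Finset.univ.map ⟨singleton, Finset.singleton_injective⟩
  have hmem : ∀ p ∈ P, ∃ v, p = {v} := by simp [P, eq_comm]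
  have hcard : P.card = Fintype.card V := by simp [P]
  have hP : (P : Set (Finset V)).PairwiseDisjoint id := by
    intro p hp q hq hpq
    obtain ⟨v, rfl⟩ := hmem p hp
    obtain ⟨w, rfl⟩ := hmem q hq
    exact Finset.disjoint_singleton.2 fun h : v = w => hpq (by rw [h])
  obtain ⟨Y, hY, hY₀, hYP⟩ := exists_isPartitionWithExceptionalSet P hP
    fun p hp => by obtain ⟨v, rfl⟩ := hmem p hp; exact Finset.singleton_nonempty v
  rw [← hcard]
  refine ⟨Y, hY, ?_, fun i j hi hj => ?_⟩
  · have : Y 0 = ∅ := by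
      rw [hY₀, Finset.sdiff_eq_empty_iff_subset]
      exact fun v _ => Finset.mem_biUnion.2 ⟨{v}, by simp [P], by simp⟩
    rw [this]
    simp only [Finset.card_empty, Nat.cast_zero]
    positivity
  · obtain ⟨v, hv⟩ := hmem _ (hYP i hi)
    obtain ⟨w, hw⟩ := hmem _ (hYP j hj)
    rw [hv, hw]
    refine ⟨by simp, ?_⟩
    by_cases h : G.Adj v w
    · right
      have : G.interedges {v} {w} = {(v, w)} := by
        ext ⟨a, b⟩
        simp only [SimpleGraph.mk_mem_interedges_iff, Finset.mem_singleton, Prod.mk.injEq]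
        exact ⟨fun h => ⟨h.1, h.2.1⟩, by rintro ⟨rfl, rfl⟩; exact ⟨rfl, rfl, h⟩⟩
      simpa [SimpleGraph.edgeDensity_def, this] using hx
    · left
      have : G.interedges {v} {w} = ∅ := by
        ext ⟨a, b⟩
        simp only [SimpleGraph.mk_mem_interedges_iff, Finset.mem_singleton, Finset.notMem_empty,
          iff_false]
        rintro ⟨rfl, rfl, h'⟩
        exact h h'
      simpa [SimpleGraph.edgeDensity_def, this] using hx

end EqualPieces

/-! ### Choice of constants and the contradiction. -/

theorem exists_equipartition_of_stable_sequence {V : ℕ → Type*} [∀ m, Fintype (V m)]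
    [∀ m, DecidableEq (V m)] (G : ∀ m, SimpleGraph (V m)) [∀ m, DecidableRel (G m).Adj] {k : ℕ}
    (hG : ∀ m, (G m).IsStable k) (hV : ∀ m, m < Fintype.card (V m)) {ε : ℝ} (hε : 0 < ε)
    {σ : ℕ → ℝ} (hσ : ∀ n, 0 < σ n) :
    ∃ m n : ℕ, n ≤ m ∧ ∃ Y : Fin (n + 1) → Finset (V m),
      IsPartitionWithExceptionalSet Y ∧ ((Y 0).card : ℝ) ≤ ε * (Fintype.card (V m) : ℝ) ∧
      ∀ i j : Fin (n + 1), i ≠ 0 → j ≠ 0 → (Y i).card = (Y j).card ∧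
        (((G m).edgeDensity (Y i) (Y j) : ℝ) < σ n ∨
          1 - σ n < ((G m).edgeDensity (Y i) (Y j) : ℝ)) := by
  have hne : ∀ m, Nonempty (V m) := fun m => Fintype.card_pos_iff.1 ((Nat.zero_le m).trans_lt (hV m))
  let U : Ultrafilter ℕ := hyperfilter ℕ
  have hU : (U : Filter ℕ) ≤ atTop := Nat.hyperfilter_le_atTop
  obtain ⟨r, A, hA, hR⟩ := exists_isLimitAtom_family (U := U) hU hG (ε := ε / 4) (by positivity)
  obtain ⟨c, hc, hcA⟩ : ∃ c : ℝ, 0 < c ∧ ∀ i, c < limitDensity U (A i) := by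
    rcases isEmpty_or_nonempty (Fin r) with h | h
    · exact ⟨1, one_pos, fun i => h.elim i⟩
    · obtain ⟨i, hi⟩ := Finite.exists_min fun i => limitDensity U (A i)
      exact ⟨_, half_pos (hA i).1, fun j => (half_lt_self (hA i).1).trans_le (hi j)⟩
  -- The order of choices matters: `r` fixes `γ`, which fixes `M`; only then are `η` (from the least
  -- `σ n` with `n ≤ M`) and the atom precision `δ` chosen.
  set γ : ℝ := ε / (2 * (r + 1)) with hγdef
  have hγ : 0 < γ := by positivity
  have hγr : γ * r ≤ ε / 2 := by
    rw [hγdef, div_mul_eq_mul_div, div_le_div_iff₀ (by positivity) two_pos]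
    nlinarith
  obtain ⟨M, hM⟩ := exists_nat_ge (2 / γ)
  rw [div_le_iff₀' hγ] at hM
  obtain ⟨n₀, -, hn₀⟩ := Finset.exists_min_image (Finset.range (M + 1)) σ ⟨0, by simp⟩
  set η : ℝ := σ n₀ * γ ^ 2 / 8 with hηdef
  have hη : 0 < η := by have := hσ n₀; positivity
  set δ : ℝ := min (η / 2) (min (c / 4) (c * (η / 2) ^ 2 / 2)) with hδdef
  have hδ : 0 < δ := by positivity
  have hδ₁ : δ ≤ η / 2 := min_le_left _ _
  have hδ₂ : δ ≤ c / 4 := (min_le_right _ _).trans (min_le_left _ _)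
  have hδ₃ : δ ≤ c * (η / 2) ^ 2 / 2 := (min_le_right _ _).trans (min_le_right _ _)
  obtain ⟨m, hgood, hlarge, hrest, hmM⟩ :=
    ((eventually_all.2 fun i => (hA i).eventually_good hδ).and
      ((eventually_all.2 fun i => eventually_lt_card_div (hcA i)).and
        ((eventually_card_div_lt (hR.trans_lt (by linarith : ε / 4 < ε / 2))).and
          (hU (eventually_ge_atTop M))))).exists
  have hN : (0 : ℝ) < Fintype.card (V m) := by exact_mod_cast Fintype.card_pos
  have hMV : (M : ℝ) ≤ Fintype.card (V m) := by exact_mod_cast hmM.trans (hV m).le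
  have hle : ∀ s : Finset (V m), (s.card : ℝ) ≤ Fintype.card (V m) := fun s => by
    exact_mod_cast Finset.card_le_univ s
  have hhom : ∀ i j,
      ((Rel.interedges (G m).Adj (A i m) (A j m)).card : ℝ) ≤
        η * (Fintype.card (V m) : ℝ) ^ 2 ∨
      ((Rel.interedges (fun a b => ¬ (G m).Adj a b) (A i m) (A j m)).card : ℝ) ≤
        η * (Fintype.card (V m) : ℝ) ^ 2 := fun i j => by
    refine (card_interedges_le_or_card_interedges_compl_le (G m).Adj (A i m) (A j m) hN hδ
      (half_pos hη) (by linarith) (by linarith) (hle _) (hle _)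
      ((lt_div_iff₀ hN).1 (hlarge i)).le (fun b _ => hgood i b)
      -- By symmetry of adjacency, the column condition is the atom property of `A j`.
      fun a _ => by simpa only [(G m).adj_comm a] using hgood j a).imp ?_ ?_ <;>
    exact fun h => h.trans (mul_le_mul_of_nonneg_right (by linarith) (sq_nonneg _))
  have hση : ∀ n ≤ M, 0 ≤ σ n ∧ 4 * η < σ n * γ ^ 2 := fun n hn => by
    have h₁ := mul_le_mul_of_nonneg_right (hn₀ n (Finset.mem_range_succ_iff.2 hn)) (sq_nonneg γ)
    exact ⟨(hσ n).le, by linarith⟩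
  obtain ⟨n, hn, Y, hY⟩ := exists_equipartition_of_homogeneous (G m) (fun i => A i m) σ hγ
    (by nlinarith) hγr ((div_lt_iff₀ hN).1 hrest).le hhom hM hση
  exact ⟨m, n, hn.trans hmM, Y, hY⟩

theorem theorem1p2 (k : ℕ) (hk : 1 ≤ k) (ε : ℝ) (hε : 0 < ε)
    (σ : ℕ → ℝ) (hσ : ∀ n, σ n ∈ Set.Ioo (0 : ℝ) 1) :
    ∃ N : ℕ, ∀ (V : Type*) [Fintype V] [DecidableEq V] (G : SimpleGraph V) [DecidableRel G.Adj],
      G.IsStable k →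
        ∃ n : ℕ, n ≤ N ∧ ∃ Y : Fin (n + 1) → Finset V,
          IsPartitionWithExceptionalSet Y ∧
          ((Y 0).card : ℝ) ≤ ε * (Fintype.card V : ℝ) ∧
          ∀ i j : Fin (n + 1), i ≠ 0 → j ≠ 0 →
            (Y i).card = (Y j).card ∧
            ((G.edgeDensity (Y i) (Y j) : ℝ) < σ n ∨
              1 - σ n < (G.edgeDensity (Y i) (Y j) : ℝ)) := by
  by_contra h
  push Not at h
  choose V instF instD G instR hG hno using h
  have hV : ∀ m, m < Fintype.card (V m) := fun m => by
    by_contra! hm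
    obtain ⟨Y, hY, hY₀, hYσ⟩ := exists_equipartition_card (G m) hε (hσ (Fintype.card (V m))).1
    obtain ⟨i, j, hi, hj, hij⟩ := hno m _ hm Y hY hY₀
    obtain ⟨h₁, h₂ | h₂⟩ := hYσ i j hi hj
    · exact ((hij h₁).1.trans_lt h₂).false
    · exact ((hij h₁).2.trans_lt h₂).false
  obtain ⟨m, n, hnm, Y, hY, hY₀, hYσ⟩ :=
    exists_equipartition_of_stable_sequence G hG hV hε fun n => (hσ n).1
  obtain ⟨i, j, hi, hj, hij⟩ := hno m n hnm Y hY hY₀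
  obtain ⟨h₁, h₂ | h₂⟩ := hYσ i j hi hj
  · exact ((hij h₁).1.trans_lt h₂).false
  · exact ((hij h₁).2.trans_lt h₂).false
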